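/- For a finite set $S$ of positive integers, rational numbers $A>B\ge 0$ such that $Ax^2+Bx$ is integer valued on the integers, and an integer $k\ge 1$, define the integers $\gamma^k_{S,A,B}(n)$, $n\ge 0$, by the identity of formal power series $$\prod_{s\in S}\frac{1}{1-q^s}\sum_{j\in\mathbb{Z},\ j\notin[-k,k-1]}(-1)^{j+k}q^{Aj^2+Bj}=\sum_{n\ge 0}\gamma^k_{S,A,B}(n)\,q^n .$$ Let $Z=\{1,4,9,11,19\}$ and $$(A,B)\in\left\{\left(\tfrac52,\tfrac32\right),\left(\tfrac52,\tfrac12\right),\left(\tfrac72,\tfrac52\right),\left(\tfrac72,\tfrac32\right)\right\}.$$ Then $\gamma^k_{Z,A,B}(n)\ge 0$ for all integers $k\ge 1$ and $n\ge 0$. Consequently (a conjecture of Merca), for the same pairs $(A,B)$ and every integer $k\ge 1$, the formal power series $$\frac{1}{(q,q^4;q^5)_\infty}\sum_{j\in\mathbb{Z},\ j\notin[-k,k-1]}(-1)^{j+k}q^{Aj^2+Bj}$$ has non-negative integer coefficients, where $(q,q^4;q^5)_\infty=\prod_{i\ge 0}(1-q^{5i+1})(1-q^{5i+4})$. -/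

import Mathlib

open scoped PowerSeries PowerSeries.WithPiTopology

noncomputable section

namespace PentagonalPositivity

/-- The set of integers `j ∉ [-k, k-1]` with `A j² + B j = n`. -/
def tailIndex (A B : ℚ) (k n : ℕ) : Set ℤ :=
  {j : ℤ | j ∉ Set.Icc (-(k : ℤ)) ((k : ℤ) - 1) ∧ A * (j : ℚ) ^ 2 + B * (j : ℚ) = (n : ℚ)}

/-- The formal power series `∑_{j ∉ [-k, k-1]} (-1)^(j+k) q^(A j² + B j)`, for an integer valued
polynomial `A x² + B x` with `A > B ≥ 0`: its coefficient at `q^n` collects the (finitely many)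
indices `j` with exponent `n`. -/
def tailSeries (A B : ℚ) (k : ℕ) : ℤ⟦X⟧ :=
  PowerSeries.mk fun n => ∑ᶠ j ∈ tailIndex A B k n, ((j + (k : ℤ)).negOnePow : ℤ)

/-- The formal power series `∏_{s ∈ S} 1 / (1 - q^s)`, for a finite set `S` of positive integers. -/
def invProd (S : Finset ℕ) : ℤ⟦X⟧ :=
  ∏ s ∈ S, Ring.inverse (1 - PowerSeries.X ^ s)

/-- The coefficient `γ^k_{S,A,B}(n)` of `q^n` in
`∏_{s ∈ S} 1 / (1 - q^s) * ∑_{j ∉ [-k, k-1]} (-1)^(j+k) q^(A j² + B j)`. -/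
def gammaCoeff (S : Finset ℕ) (A B : ℚ) (k n : ℕ) : ℤ :=
  PowerSeries.coeff n (invProd S * tailSeries A B k)

/-- The infinite product `(a; p)_∞ = ∏_{i ≥ 0} (1 - a p^i)` of formal power series
(coefficientwise convergence, integer coefficients with the discrete topology). -/
def qPochInf (a p : ℤ⟦X⟧) : ℤ⟦X⟧ :=
  ∏' i : ℕ, (1 - a * p ^ i)

/-- The series lies in `ℕ[[q]]`. -/
def IsNatSeries (f : ℤ⟦X⟧) : Prop :=
  ∃ g : ℕ⟦X⟧, PowerSeries.map (Nat.castRingHom ℤ) g = f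

/-- For `A > B ≥ 0` every exponent is attained finitely often. -/
theorem tailIndex_finite {A B : ℚ} (hB : 0 ≤ B) (hAB : B < A) (k n : ℕ) :
    (tailIndex A B k n).Finite := by
  classical
  let p : Polynomial ℚ :=
    Polynomial.C A * Polynomial.X ^ 2 + Polynomial.C B * Polynomial.X + Polynomial.C (-(n : ℚ))
  have hp : p ≠ 0 := by
    intro h
    have h2 := congrArg (fun r : Polynomial ℚ => r.coeff 2) h
    simp [p] at h2
    linarith
  have hfin : {x : ℚ | p.IsRoot x}.Finite := Polynomial.finite_setOfPred_isRoot hp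
  refine (hfin.preimage (f := fun j : ℤ => (j : ℚ)) (Int.cast_injective.injOn)).subset ?_
  intro j hj
  have h := hj.2
  simp only [Set.mem_preimage, Set.mem_ofPred_eq, Polynomial.IsRoot, p, Polynomial.eval_add,
    Polynomial.eval_mul, Polynomial.eval_pow, Polynomial.eval_C, Polynomial.eval_X]
  linarith

/-- The factors of `invProd` are genuine inverses. -/
theorem one_sub_X_pow_mul_inverse {s : ℕ} (hs : 0 < s) :
    (1 - PowerSeries.X ^ s : ℤ⟦X⟧) * Ring.inverse (1 - PowerSeries.X ^ s) = 1 := by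
  apply Ring.mul_inverse_cancel
  rw [PowerSeries.isUnit_iff_constantCoeff]
  simp [hs.ne']

/-- The product `(q^r; q^m)_∞` converges when `m ≥ 1`. -/
theorem multipliable_qPochInf (r : ℕ) {m : ℕ} (hm : 0 < m) :
    Multipliable fun i : ℕ =>
      (1 - PowerSeries.X ^ r * (PowerSeries.X ^ m) ^ i : ℤ⟦X⟧) := by
  have h := PowerSeries.WithPiTopology.multipliable_one_add_of_tendsto_order_atTop_nhds_top
    (R := ℤ) (f := fun i : ℕ => -(PowerSeries.X ^ r * (PowerSeries.X ^ m) ^ i : ℤ⟦X⟧)) ?_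
  · simpa [sub_eq_add_neg] using h
  · refine ENat.tendsto_nhds_top_iff_natCast_lt.mpr fun n => ?_
    filter_upwards [Filter.eventually_gt_atTop n] with i hi
    rw [PowerSeries.order_neg, ← pow_mul, ← pow_add, PowerSeries.order_X_pow]
    norm_cast
    nlinarith

/-- The product `(q^r; q^m)_∞` is invertible when `r, m ≥ 1`. -/
theorem isUnit_qPochInf {r m : ℕ} (hr : 0 < r) (hm : 0 < m) :
    IsUnit (qPochInf (PowerSeries.X ^ r) (PowerSeries.X ^ m)) := by
  rw [PowerSeries.isUnit_iff_constantCoeff, qPochInf,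
    (multipliable_qPochInf r hm).map_tprod _
      (PowerSeries.WithPiTopology.continuous_constantCoeff ℤ)]
  simp [hr.ne']

end PentagonalPositivity

end

/-!
Write `A = d + w / 2` and `B = w / 2` with integers `d` and `w`, and let
`a r = A r² + B r` be the exponent attached to the index `r`. Pairing the indices `r` and
`-r - 1`, the tail becomes `∑_{r ≥ k} (-1)^(r-k) (q^(a r) - q^(a r + d (2 r + 1)))`.

Since the numbers `1, 4, 9, 11, 19` are pairwise coprime, the partial fraction decomposition of
`G = 1 / ((1-q)(1-q^4)(1-q^9)(1-q^11)(1-q^19))` is a combination of `1 / (1-q)^j`, `j ≤ 5`, with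
positive coefficients, and of a series with bounded periodic coefficients (`partial_fractions`).
Hence a coefficient of `G` times the tail is a combination of the iterated partial sums
`M₁, …, M₅` of the tail and an error of size at most a constant times the number of exponents up to
`n`. In the block of the `i`-th exponent this number is at most `2 (i + 1)`, and `M₁` and `M₂` are
bounded below by `-1` and `-d (i + 1)`.

The main point is that `M₃` is nonnegative, and more precisely at least `k (2 k + 1)` from an early
position on (`IsTailCoeff.le_psum_psum_psum`). This follows from closed formulas for the partial
sums: over every pair of consecutive blocks `M₃` grows, and its dips within a block are small
compared with the growth accumulated before. Therefore `M₅` grows at least quadratically in the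
distance `x` from the first exponent, whereas the negative contributions are at most linear in
`x / (5 k + 3)`. The former outweigh the latter for all `k ≥ 5` as soon as the second exponent is
reached, and for `k ≤ 4` when `x` is not too small (`coeff_nonneg_of_large`). Before the second
exponent the coefficients are trivially nonnegative (`coeff_nonneg_of_small`), and the finitely many
remaining ones are computed (`coeff_nonneg_of_initialSegment`).

For the infinite product, the partial products of `1 / ((1-q^(5i+1)) (1-q^(5i+4)))` contain `G`
as a factor once `i = 3` is reached, and the complementary factors have nonnegative coefficients;
the claim passes to the limit because the coefficients are continuous.
-/

namespace PentagonalPositivity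

/-! ### The exponents of the tail -/

/-- The exponent `A r² + B r` for `A = d + w / 2`, `B = w / 2`. -/
def expo (d w r : ℕ) : ℕ := d * r ^ 2 + w * (r + 1).choose 2

/-- The difference of the exponents attached to the indices `-r - 1` and `r`. -/
def cut (d r : ℕ) : ℕ := d * (2 * r + 1)

/-- The difference of the exponents attached to the indices `r + 1` and `r`. -/
def gap (d w r : ℕ) : ℕ := cut d r + w * (r + 1)

theorem expo_succ (d w r : ℕ) : expo d w (r + 1) = expo d w r + gap d w r := by
  simp only [expo, gap, cut, Nat.choose_succ_succ (r + 1) 1, Nat.choose_one_right]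
  ring

theorem expo_mono (d w : ℕ) : Monotone (expo d w) :=
  monotone_nat_of_le_succ fun r => by rw [expo_succ]; omega

theorem cut_lt_gap {d w : ℕ} (hw : 0 < w) (r : ℕ) : cut d r < gap d w r := by
  have : 0 < w * (r + 1) := by positivity
  unfold gap
  omega

theorem block_unique {d w r r' s s' : ℕ} (hs : s < gap d w r) (hs' : s' < gap d w r')
    (h : expo d w r + s = expo d w r' + s') : r = r' ∧ s = s' := by
  have key : ∀ {a b t u : ℕ}, a < b → t < gap d w a → expo d w a + t ≠ expo d w b + u := by
    intro a b t u hab ht h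
    have := expo_mono d w (Nat.succ_le_of_lt hab)
    rw [Nat.succ_eq_add_one, expo_succ] at this
    omega
  rcases lt_trichotomy r r' with hr | hr | hr
  · exact absurd h (key hr hs)
  · subst hr
    exact ⟨rfl, by omega⟩
  · exact absurd h.symm (key hr hs')

/-- Every `n ≥ expo k` lies in a block `[expo r, expo (r + 1))` with `r ≥ k`. -/
theorem exists_block {d w k n : ℕ} (hd : 0 < d) (hn : expo d w k ≤ n) :
    ∃ i s, s < gap d w (k + i) ∧ n = expo d w (k + i) + s := by
  have hpos : ∀ r, 0 < gap d w r := fun r => by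
    have : 0 < cut d r := by unfold cut; positivity
    unfold gap
    omega
  induction n, hn using Nat.le_induction with
  | base => exact ⟨0, 0, hpos _, rfl⟩
  | succ n _ ih =>
    obtain ⟨i, s, hs, rfl⟩ := ih
    by_cases h : s + 1 < gap d w (k + i)
    · exact ⟨i, s + 1, h, rfl⟩
    · refine ⟨i + 1, 0, hpos _, ?_⟩
      rw [← add_assoc k, expo_succ]
      omega

/-- `τ` is the coefficient sequence of `∑_{r ≥ k} (-1)^(r-k) (q^(expo r) - q^(expo r + cut r))`. -/
structure IsTailCoeff (d w k : ℕ) (τ : ℕ → ℤ) : Prop where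
  eq_zero : ∀ n < expo d w k, τ n = 0
  block : ∀ i s, s < gap d w (k + i) → τ (expo d w (k + i) + s) =
    (-1) ^ i * ((if s = 0 then 1 else 0) - (if s = cut d (k + i) then 1 else 0))

/-- The index `j = r ≥ k` has the exponent `expo r`, and `j = -r - 1` the exponent
`expo r + cut r`. -/
theorem mem_tailIndex {d w k n : ℕ} {j : ℤ} :
    j ∈ tailIndex (d + w / 2) (w / 2) k n ↔
      ∃ i : ℕ, (j = k + i ∧ expo d w (k + i) = n) ∨
        (j = -(k + i : ℕ) - 1 ∧ expo d w (k + i) + cut d (k + i) = n) := by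
  have hexpo : ∀ r : ℕ, ((expo d w r : ℕ) : ℚ) = (d + w / 2) * r ^ 2 + w / 2 * r := by
    intro r
    simp only [expo, Nat.cast_add, Nat.cast_mul, Nat.cast_pow, Nat.cast_choose_two]
    push_cast
    ring
  have hneg : ∀ r : ℕ, ((expo d w r + cut d r : ℕ) : ℚ) =
      (d + w / 2) * (-r - 1 : ℚ) ^ 2 + w / 2 * (-r - 1 : ℚ) := by
    intro r
    rw [Nat.cast_add, hexpo]
    simp only [cut]
    push_cast
    ring
  constructor
  · rintro ⟨hj, he⟩
    rw [Set.mem_Icc, not_and_or, not_le, not_le] at hj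
    rcases hj with hj | hj
    · refine ⟨(-j - 1 - k).toNat, Or.inr ⟨by push_cast; omega, ?_⟩⟩
      rw [← Nat.cast_inj (R := ℚ), hneg, ← he]
      have : (((k + (-j - 1 - k).toNat : ℕ) : ℤ) : ℚ) = ((-j - 1 : ℤ) : ℚ) := by
        congr 1
        push_cast
        omega
      rw [Int.cast_natCast] at this
      rw [this]
      push_cast
      ring
    · refine ⟨(j - k).toNat, Or.inl ⟨by omega, ?_⟩⟩
      rw [← Nat.cast_inj (R := ℚ), hexpo, ← he]
      have : (((k + (j - k).toNat : ℕ) : ℤ) : ℚ) = (j : ℚ) := by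
        congr 1
        push_cast
        omega
      rw [Int.cast_natCast] at this
      rw [this]
  · rintro ⟨i, ⟨rfl, he⟩ | ⟨rfl, he⟩⟩
    · refine ⟨by rw [Set.mem_Icc]; omega, ?_⟩
      rw [← he, hexpo]
      push_cast
      ring
    · refine ⟨by rw [Set.mem_Icc]; omega, ?_⟩
      rw [← he, hneg]
      push_cast
      ring

theorem isTailCoeff_tailSeries {d w : ℕ} (hd : 0 < d) (hw : 0 < w) (k : ℕ) :
    IsTailCoeff d w k fun n => PowerSeries.coeff n (tailSeries (d + w / 2) (w / 2) k) := by
  constructor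
  · intro n hn
    have : tailIndex (d + w / 2) (w / 2) k n = ∅ := by
      ext j
      rw [mem_tailIndex]
      simp only [Set.mem_empty_iff_false, iff_false, not_exists]
      intro i hi
      have := expo_mono d w (Nat.le_add_right k i)
      omega
    simp [tailSeries, this]
  · intro i s hs
    have hpos : ∀ r, 0 < gap d w r := fun r => (Nat.zero_le _).trans_lt (cut_lt_gap hw r)
    have hset : ∀ j : ℤ, j ∈ tailIndex (d + w / 2) (w / 2) k (expo d w (k + i) + s) ↔
        (j = k + i ∧ s = 0) ∨ (j = -(k + i : ℕ) - 1 ∧ s = cut d (k + i)) := by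
      intro j
      rw [mem_tailIndex]
      constructor
      · rintro ⟨i', ⟨rfl, he⟩ | ⟨rfl, he⟩⟩
        · obtain ⟨h1, h2⟩ := block_unique (hpos _) hs he
          left
          omega
        · obtain ⟨h1, h2⟩ := block_unique (cut_lt_gap hw _) hs he
          right
          rw [← h1]
          exact ⟨rfl, h2.symm⟩
      · rintro (⟨rfl, rfl⟩ | ⟨rfl, rfl⟩)
        · exact ⟨i, Or.inl ⟨rfl, rfl⟩⟩
        · exact ⟨i, Or.inr ⟨rfl, rfl⟩⟩
    have hcut : 0 < cut d (k + i) := by unfold cut; positivity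
    have hparity : ((((k : ℤ) + i + k).negOnePow : ℤˣ) : ℤ) = (-1) ^ i := by
      rw [show (k : ℤ) + i + k = i + 2 * k by ring, Int.negOnePow_add, Int.negOnePow_two_mul]
      simp [Int.negOnePow_def]
    have hparity' : (((-((k + i : ℕ) : ℤ) - 1 + k).negOnePow : ℤˣ) : ℤ) = -(-1) ^ i := by
      rw [show -((k + i : ℕ) : ℤ) - 1 + k = -(i + 1) by push_cast; ring, Int.negOnePow_neg,
        Int.negOnePow_succ]
      simp [Int.negOnePow_def]
    simp only [tailSeries, PowerSeries.coeff_mk]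
    by_cases h0 : s = 0
    · have : tailIndex (d + w / 2) (w / 2) k (expo d w (k + i) + s) = {(k : ℤ) + i} := by
        ext j
        rw [hset, Set.mem_singleton_iff]
        omega
      rw [this, finsum_mem_singleton, hparity, if_pos h0, if_neg (by omega)]
      ring
    · by_cases h1 : s = cut d (k + i)
      · have : tailIndex (d + w / 2) (w / 2) k (expo d w (k + i) + s) =
            {-((k + i : ℕ) : ℤ) - 1} := by
          ext j
          rw [hset, Set.mem_singleton_iff]
          omega
        rw [this, finsum_mem_singleton, hparity', if_neg h0, if_pos h1]
        ring
      · have : tailIndex (d + w / 2) (w / 2) k (expo d w (k + i) + s) = ∅ := by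
          ext j
          simp only [hset, h0, h1, and_false, or_self, Set.mem_empty_iff_false]
        rw [this, finsum_mem_empty, if_neg h0, if_neg h1]
        ring

/-! ### Iterated partial sums of the tail -/

/-- The partial sums `∑_{i ≤ n} f i`: the coefficients of `f / (1 - q)`. -/
def psum (f : ℕ → ℤ) (n : ℕ) : ℤ := ∑ i ∈ Finset.range (n + 1), f i

theorem sum_range_expo_succ (f : ℕ → ℤ) (d w r : ℕ) :
    ∑ j ∈ Finset.range (expo d w (r + 1)), f j =
      ∑ j ∈ Finset.range (expo d w r), f j +
        ∑ s ∈ Finset.range (gap d w r), f (expo d w r + s) := by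
  rw [expo_succ, Finset.sum_range_add]

theorem sum_pulses (e : ℤ) {c : ℕ} (hc : 0 < c) (t : ℕ) :
    ∑ s ∈ Finset.range t, e * ((if s = 0 then 1 else 0) - (if s = c then 1 else 0)) =
      if 0 < t ∧ t ≤ c then e else 0 := by
  induction t with
  | zero => simp
  | succ t ih =>
    rw [Finset.sum_range_succ, ih]
    split_ifs <;> omega

theorem sum_step (e : ℤ) (c t : ℕ) :
    ∑ s ∈ Finset.range t, (if s < c then e else 0) = e * (min t c : ℕ) := by
  induction t with
  | zero => simp
  | succ t ih =>
    rw [Finset.sum_range_succ, ih]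
    split_ifs with h
    · rw [min_eq_left h.le, min_eq_left (by omega)]
      push_cast
      ring
    · rw [min_eq_right (by omega), min_eq_right (by omega)]
      ring

/-- The partial sums of a ramp of slope one that is cut off at height `c`. -/
def ramp (c t : ℕ) : ℤ := ∑ s ∈ Finset.range t, ((min (s + 1) c : ℕ) : ℤ)

theorem ramp_of_le {c t : ℕ} (h : t ≤ c) :
    2 * ramp c t = t * (t + 1) := by
  induction t with
  | zero => simp [ramp]
  | succ t ih =>
    rw [ramp, Finset.sum_range_succ, ← ramp, mul_add, ih (by omega), min_eq_left h]
    push_cast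
    ring

theorem ramp_of_ge {c t : ℕ} (h : c ≤ t) :
    2 * ramp c t = c * (c + 1) + 2 * (t - c) * c := by
  induction t, h using Nat.le_induction with
  | base =>
    rw [ramp_of_le le_rfl]
    ring
  | succ t ht ih =>
    rw [ramp, Finset.sum_range_succ, ← ramp, mul_add, ih, min_eq_right (by omega)]
    push_cast
    ring

theorem cut_add_le_gap (d w r : ℕ) : cut d r ≤ gap d w r := Nat.le_add_right _ _

theorem neg_one_pow_cases (i : ℕ) : ((-1 : ℤ) ^ i = 1) ∨ ((-1 : ℤ) ^ i = -1) :=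
  neg_one_pow_eq_or ℤ i

namespace IsTailCoeff

variable {d w k : ℕ} {τ : ℕ → ℤ}

theorem sum_range_block (h : IsTailCoeff d w k τ) (hd : 0 < d) {i t : ℕ}
    (ht : t ≤ gap d w (k + i)) :
    ∑ s ∈ Finset.range t, τ (expo d w (k + i) + s) =
      if 0 < t ∧ t ≤ cut d (k + i) then (-1) ^ i else 0 := by
  rw [← sum_pulses ((-1) ^ i) (show 0 < cut d (k + i) by unfold cut; positivity)]
  refine Finset.sum_congr rfl fun s hs => h.block i s ?_
  have := Finset.mem_range.mp hs
  omega

theorem sum_range_expo (h : IsTailCoeff d w k τ) (hd : 0 < d) (hw : 0 < w) (i : ℕ) :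
    ∑ j ∈ Finset.range (expo d w (k + i)), τ j = 0 := by
  induction i with
  | zero => exact Finset.sum_eq_zero fun j hj => h.eq_zero j (Finset.mem_range.mp hj)
  | succ i ih =>
    rw [← add_assoc, sum_range_expo_succ, ih, h.sum_range_block hd le_rfl, if_neg]
    · simp
    · have := cut_lt_gap (d := d) hw (k + i)
      omega

theorem psum_eq_zero (h : IsTailCoeff d w k τ) {n : ℕ} (hn : n < expo d w k) :
    psum τ n = 0 :=
  Finset.sum_eq_zero fun j hj => h.eq_zero j (by
    have := Finset.mem_range.mp hj
    omega)

theorem psum_block (h : IsTailCoeff d w k τ) (hd : 0 < d) (hw : 0 < w) {i s : ℕ}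
    (hs : s < gap d w (k + i)) :
    psum τ (expo d w (k + i) + s) = if s < cut d (k + i) then (-1) ^ i else 0 := by
  rw [psum, add_assoc, Finset.sum_range_add, h.sum_range_expo hd hw, zero_add,
    h.sum_range_block hd (by omega)]
  congr 1
  simp

theorem neg_one_le_psum (h : IsTailCoeff d w k τ) (hd : 0 < d) (hw : 0 < w) (n : ℕ) :
    -1 ≤ psum τ n := by
  by_cases hn : expo d w k ≤ n
  · obtain ⟨i, s, hs, rfl⟩ := exists_block hd hn
    rw [h.psum_block hd hw hs]
    rcases neg_one_pow_cases i with hi | hi <;> rw [hi] <;> split_ifs <;> norm_num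
  · rw [h.psum_eq_zero (by omega)]
    norm_num

theorem psum_nonneg_of_lt (h : IsTailCoeff d w k τ) (hd : 0 < d) (hw : 0 < w) {n : ℕ}
    (hn : n < expo d w (k + 1)) : 0 ≤ psum τ n := by
  by_cases hn' : expo d w k ≤ n
  · rw [expo_succ] at hn
    obtain ⟨s, rfl⟩ := Nat.exists_eq_add_of_le hn'
    have := h.psum_block hd hw (i := 0) (s := s) (by rw [add_zero]; omega)
    rw [add_zero] at this
    rw [this]
    split_ifs <;> norm_num
  · rw [h.psum_eq_zero (by omega)]

theorem sum_range_psum_block (h : IsTailCoeff d w k τ) (hd : 0 < d) (hw : 0 < w) {i t : ℕ}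
    (ht : t ≤ gap d w (k + i)) :
    ∑ s ∈ Finset.range t, psum τ (expo d w (k + i) + s) =
      (-1) ^ i * (min t (cut d (k + i)) : ℕ) := by
  rw [← sum_step]
  refine Finset.sum_congr rfl fun s hs => h.psum_block hd hw ?_
  have := Finset.mem_range.mp hs
  omega

theorem sum_range_psum_expo (h : IsTailCoeff d w k τ) (hd : 0 < d) (hw : 0 < w) (i : ℕ) :
    ∑ j ∈ Finset.range (expo d w (k + i)), psum τ j = d * (k - (-1) ^ i * (k + i)) := by
  induction i with
  | zero =>
    rw [add_zero, Finset.sum_eq_zero fun j hj => h.psum_eq_zero (Finset.mem_range.mp hj)]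
    simp
  | succ i ih =>
    rw [← add_assoc, sum_range_expo_succ, ih, h.sum_range_psum_block hd hw le_rfl,
      min_eq_right (cut_add_le_gap _ _ _)]
    simp only [cut]
    push_cast
    ring

theorem psum_psum_block (h : IsTailCoeff d w k τ) (hd : 0 < d) (hw : 0 < w) {i s : ℕ}
    (hs : s < gap d w (k + i)) :
    psum (psum τ) (expo d w (k + i) + s) =
      d * (k - (-1) ^ i * (k + i)) + (-1) ^ i * (min (s + 1) (cut d (k + i)) : ℕ) := by
  rw [psum, add_assoc, Finset.sum_range_add, h.sum_range_psum_expo hd hw,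
    h.sum_range_psum_block hd hw (by omega)]

theorem psum_psum_eq_zero (h : IsTailCoeff d w k τ) {n : ℕ} (hn : n < expo d w k) :
    psum (psum τ) n = 0 :=
  Finset.sum_eq_zero fun j hj => h.psum_eq_zero (by
    have := Finset.mem_range.mp hj
    omega)

theorem le_psum_psum (h : IsTailCoeff d w k τ) (hd : 0 < d) (hw : 0 < w) {i s : ℕ}
    (hs : s < gap d w (k + i)) :
    -(d * (i + 1) : ℤ) ≤ psum (psum τ) (expo d w (k + i) + s) := by
  rw [h.psum_psum_block hd hw hs]
  have hdi : (0 : ℤ) ≤ d * i := by positivity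
  have hdk : (0 : ℤ) ≤ d * k := by positivity
  have hmin : min (s + 1) (cut d (k + i)) ≤ d * (2 * (k + i) + 1) := min_le_right _ _
  have hmin' : ((min (s + 1) (cut d (k + i)) : ℕ) : ℤ) ≤ d * (2 * (k + i) + 1) := by
    exact_mod_cast hmin
  rcases neg_one_pow_cases i with hi | hi <;> rw [hi]
  · have : (0 : ℤ) ≤ (min (s + 1) (cut d (k + i)) : ℕ) := by positivity
    nlinarith
  · nlinarith

theorem sum_range_psum_psum_block (h : IsTailCoeff d w k τ) (hd : 0 < d) (hw : 0 < w) {i t : ℕ}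
    (ht : t ≤ gap d w (k + i)) :
    ∑ s ∈ Finset.range t, psum (psum τ) (expo d w (k + i) + s) =
      t * (d * (k - (-1) ^ i * (k + i))) +
        (-1) ^ i * ramp (cut d (k + i)) t := by
  rw [Finset.sum_congr rfl fun s hs => h.psum_psum_block hd hw (i := i) (s := s) (by
    have := Finset.mem_range.mp hs
    omega), Finset.sum_add_distrib, Finset.sum_const, Finset.card_range, nsmul_eq_mul,
    ramp, Finset.mul_sum]

/-- The closed formula for the third partial sums at the end of a pair of consecutive blocks; for
`k ≥ 1` it is increasing in `i`. -/
theorem sum_range_psum_psum_expo (h : IsTailCoeff d w k τ) (hd : 0 < d) (hw : 0 < w) (i : ℕ) :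
    ∑ j ∈ Finset.range (expo d w (k + 2 * i)), psum (psum τ) j =
      d * (d * (4 * k * i * (k + i) - i) + w * ((k - 1) * i * (2 * k + 2 * i + 1)) - i) := by
  induction i with
  | zero =>
    rw [mul_zero, add_zero,
      Finset.sum_eq_zero fun j hj => h.psum_psum_eq_zero (Finset.mem_range.mp hj)]
    simp
  | succ i ih =>
    have h1 := ramp_of_ge (cut_add_le_gap d w (k + 2 * i))
    have h2 := ramp_of_ge (cut_add_le_gap d w (k + (2 * i + 1)))
    rw [show k + 2 * (i + 1) = k + (2 * i + 1) + 1 by ring, sum_range_expo_succ, ← add_assoc k,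
      sum_range_expo_succ, ih, add_assoc k, h.sum_range_psum_psum_block hd hw le_rfl,
      h.sum_range_psum_psum_block hd hw le_rfl]
    generalize ramp (cut d (k + 2 * i)) (gap d w (k + 2 * i)) = x at *
    generalize ramp (cut d (k + (2 * i + 1))) (gap d w (k + (2 * i + 1))) = y at *
    have e1 : (-1 : ℤ) ^ (2 * i) = 1 := by simp
    have e2 : (-1 : ℤ) ^ (2 * i + 1) = -1 := by simp [pow_succ]
    rw [e1, e2]
    simp only [gap, cut] at *
    push_cast at *
    refine mul_left_cancel₀ (two_ne_zero (α := ℤ)) ?_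
    linear_combination h1 - h2

/-- In a block of positive sign the second partial sums may start negative, and the third ones dip
by at most `2 (d m)²`, which is outweighed by the growth over the `m` pairs of blocks before it. -/
theorem le_of_even_block (h : IsTailCoeff d w k τ) (hd : 0 < d) (hw : 0 < w) (hk : 0 < k)
    {m t : ℕ} (ht : t ≤ gap d w (k + 2 * m)) (hmt : 0 < m ∨ cut d k ≤ t) :
    (k * (2 * k + 1) : ℤ) ≤ ∑ j ∈ Finset.range (expo d w (k + 2 * m)), psum (psum τ) j +
      ∑ s ∈ Finset.range t, psum (psum τ) (expo d w (k + 2 * m) + s) := by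
  have hU := h.sum_range_psum_psum_expo hd hw m
  have e1 : (-1 : ℤ) ^ (2 * m) = 1 := by simp
  rw [h.sum_range_psum_psum_block hd hw ht, hU, e1]
  have hd' : (1 : ℤ) ≤ d := by exact_mod_cast hd
  have hk' : (1 : ℤ) ≤ k := by exact_mod_cast hk
  have hw' : (0 : ℤ) ≤ w * ((k - 1) * m * (2 * k + 2 * m + 1)) := by
    have : (0 : ℤ) ≤ k - 1 := by omega
    positivity
  have hdw := mul_nonneg (zero_le_one.trans hd') hw'
  generalize hR : ramp (cut d (k + 2 * m)) t = R
  push_cast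
  have hc : ((cut d (k + 2 * m) : ℕ) : ℤ) = d * (2 * (k + 2 * m) + 1) := by
    simp only [cut]
    push_cast
    ring
  have ht0 : (0 : ℤ) ≤ t := by positivity
  have hm0 : (0 : ℤ) ≤ m := by positivity
  rcases Nat.eq_zero_or_pos m with rfl | hm
  · -- The first block: only the part beyond `cut d k` is concerned, where the sum increases.
    have hct : cut d (k + 2 * 0) ≤ t := by simpa using hmt
    have h2 := ramp_of_ge hct
    rw [hR, hc] at h2
    have hct' : ((cut d (k + 2 * 0) : ℕ) : ℤ) ≤ t := by exact_mod_cast hct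
    rw [hc] at hct'
    push_cast at h2 hct' ⊢
    have hA : (2 * k + 1 : ℤ) ≤ d * (2 * k + 1) := by nlinarith
    have hB := mul_le_mul hA hA (by positivity) (by positivity)
    have hC : (0 : ℤ) ≤ (t - d * (2 * (k + 2 * 0) + 1)) * (d * (2 * (k + 2 * 0) + 1)) :=
      mul_nonneg (by linarith) (by positivity)
    nlinarith
  · have hm' : (1 : ℤ) ≤ m := by exact_mod_cast hm
    have hramp : -(2 * (d * m) ^ 2 : ℤ) ≤ R - 2 * (d * m) * t := by
      rcases le_total t (cut d (k + 2 * m)) with hct | hct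
      · have h2 := ramp_of_le hct
        rw [hR] at h2
        nlinarith [sq_nonneg ((t : ℤ) - 2 * (d * m))]
      · have h2 := ramp_of_ge hct
        rw [hR, hc] at h2
        have hct' : ((cut d (k + 2 * m) : ℕ) : ℤ) ≤ t := by exact_mod_cast hct
        rw [hc] at hct'
        have hC : (0 : ℤ) ≤ (t - d * (2 * (k + 2 * m) + 1)) *
            (d * (2 * (k + 2 * m) + 1) - 2 * (d * m)) :=
          mul_nonneg (by linarith) (by
            rw [show (d * (2 * (k + 2 * m) + 1) - 2 * (d * m) : ℤ) = d * (2 * k + 2 * m + 1) by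
              ring]
            positivity)
        have hD : (0 : ℤ) ≤ d * (2 * (k + 2 * m) + 1) := by positivity
        nlinarith [sq_nonneg ((d * (2 * (k + 2 * m) + 1) : ℤ) - 2 * (d * m))]
    have hdd : (d * m : ℤ) ≤ d ^ 2 * m := by
      nlinarith [mul_nonneg (mul_nonneg hm0 (zero_le_one.trans hd')) (sub_nonneg.2 hd')]
    have hkm : (4 * k ^ 2 : ℤ) ≤ 4 * k * m * (k + m) - 2 * m - 2 * m ^ 2 := by
      have : (0 : ℤ) ≤ (k - 1) * m ^ 2 := mul_nonneg (by linarith) (by positivity)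
      have : (0 : ℤ) ≤ k ^ 2 * (m - 1) := mul_nonneg (by positivity) (by linarith)
      nlinarith
    have hd2 : (1 : ℤ) ≤ d ^ 2 := one_le_pow₀ hd'
    have hfin : (1 * (4 * k ^ 2) : ℤ) ≤ d ^ 2 * (4 * k * m * (k + m) - 2 * m - 2 * m ^ 2) :=
      mul_le_mul hd2 hkm (by positivity) (by positivity)
    nlinarith

theorem le_of_odd_block (h : IsTailCoeff d w k τ) (hd : 0 < d) (hw : 0 < w) (hk : 0 < k)
    {m t : ℕ} (ht : t ≤ gap d w (k + (2 * m + 1))) :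
    (k * (2 * k + 1) : ℤ) ≤
      ∑ j ∈ Finset.range (expo d w (k + (2 * m + 1))), psum (psum τ) j +
        ∑ s ∈ Finset.range t, psum (psum τ) (expo d w (k + (2 * m + 1)) + s) := by
  -- The block sum is concave in `t`, so it is bounded by its values at the two ends.
  have hstart : (k * (2 * k + 1) : ℤ) ≤
      ∑ j ∈ Finset.range (expo d w (k + (2 * m + 1))), psum (psum τ) j := by
    have := h.le_of_even_block hd hw hk (m := m) le_rfl (by
      rcases Nat.eq_zero_or_pos m with rfl | hm
      · exact Or.inr (cut_add_le_gap d w k)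
      · exact Or.inl hm)
    rwa [← sum_range_expo_succ] at this
  have hend := h.le_of_even_block hd hw hk (m := m + 1) (t := 0) (by omega) (by omega)
  rw [Finset.sum_range_zero, add_zero, show k + 2 * (m + 1) = k + (2 * m + 1) + 1 by ring,
    sum_range_expo_succ] at hend
  have e1 : (-1 : ℤ) ^ (2 * m + 1) = -1 := by simp [pow_succ]
  rw [h.sum_range_psum_psum_block hd hw le_rfl, e1] at hend
  rw [h.sum_range_psum_psum_block hd hw ht, e1]
  have hc : ((cut d (k + (2 * m + 1)) : ℕ) : ℤ) = d * (2 * (k + (2 * m + 1)) + 1) := by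
    simp only [cut]
    push_cast
    ring
  have h3 := ramp_of_ge (cut_add_le_gap d w (k + (2 * m + 1)))
  have hd' : (1 : ℤ) ≤ d := by exact_mod_cast hd
  have hk' : (1 : ℤ) ≤ k := by exact_mod_cast hk
  rcases le_total t (cut d (k + (2 * m + 1))) with hct | hct
  · have h2 := ramp_of_le hct
    have hct' : ((t : ℕ) : ℤ) ≤ (cut d (k + (2 * m + 1)) : ℕ) := by exact_mod_cast hct
    rw [hc] at hct'
    have hE : (0 : ℤ) ≤ t * (2 * d * (k + (k + (2 * m + 1))) - t - 1) :=
      mul_nonneg (by positivity) (by nlinarith)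
    push_cast
    nlinarith
  · have h2 := ramp_of_ge hct
    rw [hc] at h2 h3
    have ht' : ((t : ℕ) : ℤ) ≤ (gap d w (k + (2 * m + 1)) : ℕ) := by exact_mod_cast ht
    have hE : (0 : ℤ) ≤ ((gap d w (k + (2 * m + 1)) : ℕ) - t) * (d * (2 * m + 2)) :=
      mul_nonneg (by linarith) (by positivity)
    push_cast at hend ⊢
    nlinarith

/-- A lower bound for the third partial sums which does not depend on `d` and `w`: they grow like
triangular numbers up to the value `k (2 k + 1)` and never fall below it later. -/
theorem le_psum_psum_psum (h : IsTailCoeff d w k τ) (hd : 0 < d) (hw : 0 < w) (hk : 0 < k)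
    (x : ℕ) :
    ((min (x + 1) (2 * k) : ℕ) * ((min (x + 1) (2 * k) : ℕ) + 1) : ℤ) ≤
      2 * psum (psum (psum τ)) (expo d w k + x) := by
  have hbig : ∀ y : ℤ, (k * (2 * k + 1) : ℤ) ≤ y →
      ((min (x + 1) (2 * k) : ℕ) * ((min (x + 1) (2 * k) : ℕ) + 1) : ℤ) ≤ 2 * y := by
    intro y hy
    have : ((min (x + 1) (2 * k) : ℕ) : ℤ) ≤ 2 * k := by
      exact_mod_cast min_le_right (x + 1) (2 * k)
    nlinarith [(min (x + 1) (2 * k)).cast_nonneg (α := ℤ)]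
  obtain ⟨i, s, hs, hx⟩ := exists_block (n := expo d w k + x) hd (Nat.le_add_right _ _)
  rw [psum, hx, add_assoc, Finset.sum_range_add]
  obtain ⟨m, rfl | rfl⟩ := i.even_or_odd'
  · by_cases hm : 0 < m ∨ cut d k ≤ s + 1
    · exact hbig _ (h.le_of_even_block hd hw hk (by omega) hm)
    · obtain rfl : m = 0 := by omega
      obtain rfl : x = s := by simpa using hx
      have hct : x + 1 ≤ cut d (k + 2 * 0) := by
        rw [mul_zero, add_zero]
        omega
      have h2 := ramp_of_le hct
      rw [h.sum_range_psum_psum_block hd hw (by omega), h.sum_range_psum_psum_expo hd hw]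
      have : ((min (x + 1) (2 * k) : ℕ) : ℤ) ≤ x + 1 := by
        exact_mod_cast min_le_left (x + 1) (2 * k)
      have h0 := (min (x + 1) (2 * k)).cast_nonneg (α := ℤ)
      generalize ((min (x + 1) (2 * k) : ℕ) : ℤ) = y at *
      push_cast at h2 ⊢
      nlinarith
  · exact hbig _ (h.le_of_odd_block hd hw hk (by omega))

/-- Two exponents in each block: at most `2 (i + 1)` of them up to a point of the `i`-th block. -/
theorem sum_range_abs_le (h : IsTailCoeff d w k τ) {i s : ℕ}
    (hs : s < gap d w (k + i)) :
    ∑ j ∈ Finset.range (expo d w (k + i) + s + 1), |τ j| ≤ 2 * (i + 1) := by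
  have hblock : ∀ i t, t ≤ gap d w (k + i) →
      ∑ s ∈ Finset.range t, |τ (expo d w (k + i) + s)| ≤ 2 := by
    intro i t ht
    have hpulse : ∀ c : ℕ, ∑ s ∈ Finset.range t, (if s = c then (1 : ℤ) else 0) ≤ 1 := by
      intro c
      rw [Finset.sum_ite_eq']
      split_ifs <;> norm_num
    calc ∑ s ∈ Finset.range t, |τ (expo d w (k + i) + s)|
        ≤ ∑ s ∈ Finset.range t,
          ((if s = 0 then (1 : ℤ) else 0) + (if s = cut d (k + i) then 1 else 0)) := by
          refine Finset.sum_le_sum fun s hs => ?_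
          rw [h.block i s (by
            have := Finset.mem_range.mp hs
            omega), abs_mul, abs_pow, abs_neg, abs_one, one_pow, one_mul]
          split_ifs <;> norm_num
      _ ≤ 2 := by
          rw [Finset.sum_add_distrib]
          linarith [hpulse 0, hpulse (cut d (k + i))]
  have hexpo : ∀ i : ℕ, ∑ j ∈ Finset.range (expo d w (k + i)), |τ j| ≤ 2 * i := by
    intro i
    induction i with
    | zero =>
      rw [Finset.sum_eq_zero fun j hj => by rw [h.eq_zero j (Finset.mem_range.mp hj), abs_zero]]
      simp
    | succ i ih =>
      rw [← add_assoc, sum_range_expo_succ]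
      have := hblock i _ le_rfl
      push_cast
      linarith
  rw [add_assoc, Finset.sum_range_add]
  have := hexpo i
  have := hblock i (s + 1) (by omega)
  linarith

end IsTailCoeff

/-! ### Geometric series and the partial fraction decomposition -/

/-- The geometric series `1 / (1 - q^s)`. -/
noncomputable abbrev geom (s : ℕ) : ℤ⟦X⟧ := Ring.inverse (1 - PowerSeries.X ^ s)

theorem geom_eq_mk {s : ℕ} (hs : 0 < s) :
    geom s = PowerSeries.mk fun n => if s ∣ n then (1 : ℤ) else 0 := by
  have h : (1 - PowerSeries.X ^ s : ℤ⟦X⟧) *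
      PowerSeries.mk (fun n => if s ∣ n then (1 : ℤ) else 0) = 1 := by
    ext n
    rw [sub_mul, one_mul, map_sub, PowerSeries.coeff_X_pow_mul', PowerSeries.coeff_mk,
      PowerSeries.coeff_one]
    by_cases hn : s ≤ n
    · rw [if_pos hn, PowerSeries.coeff_mk, if_neg (show n ≠ 0 by omega)]
      have : s ∣ n - s ↔ s ∣ n := by
        rw [← Nat.dvd_add_self_right, Nat.sub_add_cancel hn]
      simp [this]
    · rw [if_neg hn]
      have : s ∣ n ↔ n = 0 := ⟨fun h => Nat.eq_zero_of_dvd_of_lt h (by omega), by rintro rfl; simp⟩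
      simp [this]
  calc geom s = geom s * ((1 - PowerSeries.X ^ s : ℤ⟦X⟧) *
      PowerSeries.mk (fun n => if s ∣ n then (1 : ℤ) else 0)) := by rw [h, mul_one]
    _ = _ := by rw [← mul_assoc, mul_comm (geom s), one_sub_X_pow_mul_inverse hs, one_mul]

theorem coeff_geom_nonneg {s : ℕ} (hs : 0 < s) (n : ℕ) : 0 ≤ PowerSeries.coeff n (geom s) := by
  rw [geom_eq_mk hs, PowerSeries.coeff_mk]
  split_ifs <;> norm_num

theorem coeff_mul_nonneg {f g : ℤ⟦X⟧} (hf : ∀ n, 0 ≤ PowerSeries.coeff n f)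
    (hg : ∀ n, 0 ≤ PowerSeries.coeff n g) (n : ℕ) : 0 ≤ PowerSeries.coeff n (f * g) := by
  rw [PowerSeries.coeff_mul]
  exact Finset.sum_nonneg fun p _ => mul_nonneg (hf _) (hg _)

theorem coeff_prod_nonneg {ι : Type*} (t : Finset ι) {f : ι → ℤ⟦X⟧}
    (hf : ∀ i ∈ t, ∀ n, 0 ≤ PowerSeries.coeff n (f i)) (n : ℕ) :
    0 ≤ PowerSeries.coeff n (∏ i ∈ t, f i) := by
  refine Finset.prod_induction f (fun g => ∀ n, 0 ≤ PowerSeries.coeff n g)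
    (fun _ _ => coeff_mul_nonneg) (fun n => ?_) hf n
  rw [PowerSeries.coeff_one]
  split_ifs <;> norm_num

theorem coeff_geom_one_mul (f : ℤ⟦X⟧) (n : ℕ) :
    PowerSeries.coeff n (geom 1 * f) = psum (fun m => PowerSeries.coeff m f) n := by
  rw [geom_eq_mk one_pos, mul_comm, PowerSeries.coeff_mul,
    Finset.Nat.sum_antidiagonal_eq_sum_range_succ_mk, psum]
  simp

/-- The power series with periodic coefficients `v (n % s)`. -/
noncomputable def periodicSeries (v : ℕ → ℤ) (s : ℕ) : ℤ⟦X⟧ := PowerSeries.mk fun n => v (n % s)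

theorem one_sub_X_pow_mul_periodicSeries (v : ℕ → ℤ) {s : ℕ} :
    (1 - PowerSeries.X ^ s : ℤ⟦X⟧) * periodicSeries v s =
      ∑ r ∈ Finset.range s, (v r : ℤ⟦X⟧) * PowerSeries.X ^ r := by
  ext n
  have hcoeff : ∀ r, PowerSeries.coeff n ((v r : ℤ⟦X⟧) * PowerSeries.X ^ r) =
      if n = r then v r else 0 := by
    intro r
    rw [← zsmul_eq_mul, map_zsmul, PowerSeries.coeff_X_pow]
    simp
  rw [sub_mul, one_mul, map_sub, PowerSeries.coeff_X_pow_mul', map_sum,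
    Finset.sum_congr rfl fun r _ => hcoeff r, Finset.sum_ite_eq, periodicSeries,
    PowerSeries.coeff_mk]
  by_cases hn : s ≤ n
  · rw [if_pos hn, PowerSeries.coeff_mk, if_neg (by simpa using hn),
      ← Nat.mod_eq_sub_mod hn, sub_self]
  · rw [if_neg hn, if_pos (by simpa using hn), Nat.mod_eq_of_lt (by omega), sub_zero]

theorem abs_coeff_mul_le {f : ℤ⟦X⟧} {b : ℤ} (hf : ∀ n, |PowerSeries.coeff n f| ≤ b)
    (g : ℤ⟦X⟧) (n : ℕ) :
    |PowerSeries.coeff n (f * g)| ≤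
      b * ∑ j ∈ Finset.range (n + 1), |PowerSeries.coeff j g| := by
  rw [mul_comm, PowerSeries.coeff_mul, Finset.Nat.sum_antidiagonal_eq_sum_range_succ_mk,
    Finset.mul_sum]
  refine (Finset.abs_sum_le_sum_abs _ _).trans (Finset.sum_le_sum fun j _ => ?_)
  rw [abs_mul, mul_comm]
  exact mul_le_mul_of_nonneg_right (hf _) (abs_nonneg _)

/-- The periodic part of the number of partitions into parts from `{1, 4, 9, 11, 19}`, multiplied
by `5417280`: since the parts are pairwise coprime, it is a sum of functions with periods
`4`, `9`, `11` and `19`. -/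
noncomputable def fluctuation : ℤ⟦X⟧ :=
  periodicSeries (fun r => 84645 * [9, -1, -7, -1].getD r 0) 4 +
  periodicSeries (fun r => 66880 * [-8, -8, -11, -8, 19, 16, 19, -8, -11].getD r 0) 9 +
  periodicSeries (fun r => 492480 * [2, 0, 2, -1, -2, 0, 0, -2, -1, 2, 0].getD r 0) 11 +
  periodicSeries (fun r => 285120 *
    [4, 7, 2, 0, 6, 0, -6, -6, 0, 6, 0, 2, 7, 4, -5, -5, -6, -5, -5].getD r 0) 19

theorem abs_coeff_fluctuation_le (n : ℕ) : |PowerSeries.coeff n fluctuation| ≤ 5013325 := by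
  have h4 : ∀ r < 4, |84645 * [9, -1, -7, -1].getD r 0| ≤ (761805 : ℤ) := by decide
  have h9 : ∀ r < 9, |66880 * [-8, -8, -11, -8, 19, 16, 19, -8, -11].getD r 0| ≤
      (1270720 : ℤ) := by decide
  have h11 : ∀ r < 11, |492480 * [2, 0, 2, -1, -2, 0, 0, -2, -1, 2, 0].getD r 0| ≤
      (984960 : ℤ) := by decide
  have h19 : ∀ r < 19, |285120 *
      [4, 7, 2, 0, 6, 0, -6, -6, 0, 6, 0, 2, 7, 4, -5, -5, -6, -5, -5].getD r 0| ≤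
      (1995840 : ℤ) := by decide
  simp only [fluctuation, periodicSeries, map_add, PowerSeries.coeff_mk]
  refine (abs_add_le _ _).trans ?_
  refine (add_le_add ((abs_add_le _ _).trans (add_le_add ((abs_add_le _ _).trans (add_le_add
    (h4 _ (Nat.mod_lt _ (by norm_num))) (h9 _ (Nat.mod_lt _ (by norm_num)))))
    (h11 _ (Nat.mod_lt _ (by norm_num))))) (h19 _ (Nat.mod_lt _ (by norm_num)))).trans ?_
  norm_num

/-- The algebra behind the partial fraction decomposition: it is reduced to the polynomial identity
`key`, where `t = 1 - q`, `y s = 1 - q^s` and `u s = y s / t`, while `v s` is the numerator of a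
periodic series `f s = v s / y s`. -/
theorem partial_fractions_of_identity {R : Type*} [CommRing R]
    {t y4 y9 y11 y19 u4 u9 u11 u19 i1 i4 i9 i11 i19 f4 f9 f11 f19 v4 v9 v11 v19 : R}
    (h4 : y4 = t * u4) (h9 : y9 = t * u9) (h11 : y11 = t * u11) (h19 : y19 = t * u19)
    (g1 : t * i1 = 1) (g4 : y4 * i4 = 1) (g9 : y9 * i9 = 1) (g11 : y11 * i11 = 1)
    (g19 : y19 * i19 = 1) (p4 : y4 * f4 = v4) (p9 : y9 * f9 = v9) (p11 : y11 * f11 = v11)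
    (p19 : y19 * f19 = v19) {n a b c d e : R}
    (key : n = (a + b * t + c * t ^ 2 + d * t ^ 3 + e * t ^ 4) * (u4 * u9 * u11 * u19) +
      v4 * (t * y9 * y11 * y19) + v9 * (t * y4 * y11 * y19) + v11 * (t * y4 * y9 * y19) +
      v19 * (t * y4 * y9 * y11)) :
    n * (i1 * (i4 * (i9 * (i11 * i19)))) =
      a * i1 ^ 5 + b * i1 ^ 4 + c * i1 ^ 3 + d * i1 ^ 2 + e * i1 + (f4 + f9 + f11 + f19) := by
  have hu : ∀ {y u i : R}, y = t * u → y * i = 1 → u * i = i1 := by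
    intro y u i hy hi
    subst hy
    linear_combination (-(u * i)) * g1 + i1 * hi
  have hf : ∀ {y i f v : R}, y * i = 1 → y * f = v → v * i = f := by
    intro y i f v hi hf
    subst hf
    linear_combination f * hi
  calc n * (i1 * (i4 * (i9 * (i11 * i19))))
      = (a + b * t + c * t ^ 2 + d * t ^ 3 + e * t ^ 4) * i1 *
          ((u4 * i4) * (u9 * i9) * (u11 * i11) * (u19 * i19)) +
        (v4 * i4) * ((t * i1) * (y9 * i9) * (y11 * i11) * (y19 * i19)) +
        (v9 * i9) * ((t * i1) * (y4 * i4) * (y11 * i11) * (y19 * i19)) +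
        (v11 * i11) * ((t * i1) * (y4 * i4) * (y9 * i9) * (y19 * i19)) +
        (v19 * i19) * ((t * i1) * (y4 * i4) * (y9 * i9) * (y11 * i11)) := by
        rw [key]
        ring
    _ = a * i1 ^ 5 + b * i1 ^ 4 * (t * i1) + c * i1 ^ 3 * (t * i1) ^ 2 +
        d * i1 ^ 2 * (t * i1) ^ 3 + e * i1 * (t * i1) ^ 4 + (f4 + f9 + f11 + f19) := by
        rw [hu h4 g4, hu h9 g9, hu h11 g11, hu h19 g19, hf g4 p4, hf g9 p9, hf g11 p11,
          hf g19 p19, g1, g4, g9, g11, g19]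
        linear_combination
          (i1 ^ 4 * b + c * i1 ^ 3 * (t * i1 + 1) + d * i1 ^ 2 * ((t * i1) ^ 2 + t * i1 + 1) +
            e * i1 * ((t * i1) ^ 3 + (t * i1) ^ 2 + t * i1 + 1)) * g1
    _ = _ := by
        rw [g1]
        ring

/-- The partial fraction decomposition of `1 / ((1-q)(1-q^4)(1-q^9)(1-q^11)(1-q^19))`. -/
theorem partial_fractions :
    5417280 * invProd {1, 4, 9, 11, 19} =
      720 * geom 1 ^ 5 + 14040 * geom 1 ^ 4 + 126660 * geom 1 ^ 3 + 677730 * geom 1 ^ 2 +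
        2245925 * geom 1 + fluctuation := by
  have hprod : invProd {1, 4, 9, 11, 19} = geom 1 * (geom 4 * (geom 9 * (geom 11 * geom 19))) := by
    rw [invProd, Finset.prod_insert (by decide), Finset.prod_insert (by decide),
      Finset.prod_insert (by decide), Finset.prod_insert (by decide), Finset.prod_singleton]
  have g1 := one_sub_X_pow_mul_inverse (s := 1) (by norm_num)
  have g4 := one_sub_X_pow_mul_inverse (s := 4) (by norm_num)
  have g9 := one_sub_X_pow_mul_inverse (s := 9) (by norm_num)
  have g11 := one_sub_X_pow_mul_inverse (s := 11) (by norm_num)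
  have g19 := one_sub_X_pow_mul_inverse (s := 19) (by norm_num)
  have p4 := one_sub_X_pow_mul_periodicSeries
    (fun r => 84645 * [9, -1, -7, -1].getD r 0) (s := 4)
  have p9 := one_sub_X_pow_mul_periodicSeries
    (fun r => 66880 * [-8, -8, -11, -8, 19, 16, 19, -8, -11].getD r 0) (s := 9)
  have p11 := one_sub_X_pow_mul_periodicSeries
    (fun r => 492480 * [2, 0, 2, -1, -2, 0, 0, -2, -1, 2, 0].getD r 0) (s := 11)
  have p19 := one_sub_X_pow_mul_periodicSeries
    (fun r => 285120 *
      [4, 7, 2, 0, 6, 0, -6, -6, 0, 6, 0, 2, 7, 4, -5, -5, -6, -5, -5].getD r 0) (s := 19)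
  rw [hprod, fluctuation]
  generalize periodicSeries _ 4 = f4 at *
  generalize periodicSeries _ 9 = f9 at *
  generalize periodicSeries _ 11 = f11 at *
  generalize periodicSeries _ 19 = f19 at *
  simp only [Finset.sum_range_succ, Finset.sum_range_zero, List.getD_cons_zero,
    List.getD_cons_succ] at p4 p9 p11 p19
  push_cast at p4 p9 p11 p19
  have hu : ∀ s, (1 - PowerSeries.X ^ s : ℤ⟦X⟧) =
      (1 - PowerSeries.X ^ 1) * ∑ j ∈ Finset.range s, PowerSeries.X ^ j := fun s => by
    rw [pow_one, mul_neg_geom_sum]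
  refine partial_fractions_of_identity (hu 4) (hu 9) (hu 11) (hu 19) g1 g4 g9 g11 g19
    p4 p9 p11 p19 ?_
  simp only [Finset.sum_range_succ, Finset.sum_range_zero]
  generalize (PowerSeries.X : ℤ⟦X⟧) = x
  ring

/-! ### Evaluation of initial segments -/

/-- Division of a list of coefficients by `1 - q^s`. The last `s` coefficients computed so far are
kept in a queue, which consists of the first list followed by the reversal of the second one: this
makes the evaluation by the kernel fast. -/
def divStep : List ℤ → List ℤ → List ℤ → List ℤ
  | _, _, [] => []
  | p :: front, back, x :: xs => (x + p) :: divStep front ((x + p) :: back) xs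
  | [], back, x :: xs =>
    match back.reverse with
    | [] => x :: divStep [] [] xs
    | p :: front => (x + p) :: divStep front [x + p] xs

/-- The list of the first partial sums of the tail, along the `m` blocks that start with the
block `r`; `e` is the sign of the block `r`. -/
def tailBlocks (d w r : ℕ) : ℕ → ℤ → List ℤ
  | 0, _ => []
  | m + 1, e => List.replicate (cut d r) e ++
      (List.replicate (w * (r + 1)) 0 ++ tailBlocks d w (r + 1) m (-e))

/-- The coefficients of the series in question, along the `m` blocks that start with `k`. -/
def initialSegment (d w k m : ℕ) : List ℤ :=
  divStep (List.replicate 19 0) [] (divStep (List.replicate 11 0) []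
    (divStep (List.replicate 9 0) [] (divStep (List.replicate 4 0) [] (tailBlocks d w k m 1))))

/-- If `ψ = φ / (1 - q^s)` and the queue holds the `s` values of `ψ` before `n` (zero at negative
arguments), then `divStep` turns the values of `φ` from `n` on into those of `ψ`. -/
theorem divStep_range' {φ ψ : ℕ → ℤ} {s : ℕ} (hs : 0 < s)
    (h : ∀ n, ψ n = φ n + if n < s then 0 else ψ (n - s)) (L n : ℕ) {front back : List ℤ}
    (hq : front ++ back.reverse =
      (List.range' n s).map fun m => if m < s then 0 else ψ (m - s)) :
    divStep front back ((List.range' n L).map φ) = (List.range' n L).map ψ := by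
  induction L generalizing n front back with
  | zero => rw [List.range'_zero, List.map_nil, List.map_nil, divStep]
  | succ L ih =>
    obtain ⟨s, rfl⟩ := Nat.exists_eq_succ_of_ne_zero hs.ne'
    have hnext : ((List.range' (n + 1) s).map fun m => if m < s + 1 then 0 else ψ (m - (s + 1))) ++
        [ψ n] = (List.range' (n + 1) (s + 1)).map
          fun m => if m < s + 1 then 0 else ψ (m - (s + 1)) := by
      rw [List.range'_concat (n := s), List.map_append]
      simp only [one_mul, List.map_cons, List.map_nil]
      rw [if_neg (by omega), show n + 1 + s - (s + 1) = n by omega]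
    rw [List.range'_succ, List.map_cons] at hq
    rw [List.range'_succ, List.map_cons, List.map_cons]
    cases front with
    | nil =>
      rw [List.nil_append] at hq
      simp only [divStep, hq]
      rw [← h n, ih (n + 1)]
      rw [← hnext]
      rfl
    | cons p front =>
      rw [List.cons_append, List.cons.injEq] at hq
      rw [divStep, hq.1, ← h n, ih (n + 1)]
      rw [← hnext, ← hq.2, List.reverse_cons, List.append_assoc]

theorem coeff_mul_eq_zero_of_lt {f : ℤ⟦X⟧} {n : ℕ} (hf : ∀ m < n, PowerSeries.coeff m f = 0)
    (g : ℤ⟦X⟧) : ∀ m < n, PowerSeries.coeff m (g * f) = 0 := by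
  intro m hm
  rw [PowerSeries.coeff_mul]
  refine Finset.sum_eq_zero fun p hp => ?_
  rw [hf _ (by
    have := Finset.HasAntidiagonal.mem_antidiagonal.mp hp
    omega), mul_zero]

theorem divStep_coeff {s : ℕ} (hs : 0 < s) {f : ℤ⟦X⟧} {n : ℕ}
    (hf : ∀ m < n, PowerSeries.coeff m f = 0) (L : ℕ) :
    divStep (List.replicate s 0) [] ((List.range' n L).map fun m => PowerSeries.coeff m f) =
      (List.range' n L).map fun m => PowerSeries.coeff m (geom s * f) := by
  have hzero := coeff_mul_eq_zero_of_lt hf (geom s)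
  refine divStep_range' (ψ := fun m => PowerSeries.coeff m (geom s * f)) hs ?_ L n ?_
  rotate_left
  · rw [List.reverse_nil, List.append_nil, eq_comm, List.eq_replicate_iff]
    refine ⟨by simp, ?_⟩
    intro b hb
    obtain ⟨m, hm, rfl⟩ := List.mem_map.mp hb
    rw [List.mem_range'_1] at hm
    split_ifs
    · rfl
    · exact hzero _ (by omega)
  · intro m
    have h : geom s * f = f + PowerSeries.X ^ s * (geom s * f) := by
      linear_combination f * one_sub_X_pow_mul_inverse hs
    conv_lhs => rw [h]
    rw [map_add, PowerSeries.coeff_X_pow_mul']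
    congr 1
    split_ifs <;> omega

theorem IsTailCoeff.tailBlocks_eq {d w k : ℕ} {τ : ℕ → ℤ} (h : IsTailCoeff d w k τ) (hd : 0 < d)
    (hw : 0 < w) (m i : ℕ) :
    ∃ L, expo d w (k + i) + L = expo d w (k + i + m) ∧
      tailBlocks d w (k + i) m ((-1) ^ i) = (List.range' (expo d w (k + i)) L).map (psum τ) := by
  induction m generalizing i with
  | zero => exact ⟨0, rfl, rfl⟩
  | succ m ih =>
    obtain ⟨L, hL, hb⟩ := ih (i + 1)
    refine ⟨gap d w (k + i) + L, ?_, ?_⟩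
    · rw [← add_assoc, ← expo_succ, add_assoc k, hL]
      congr 1
      ring
    · have e : (-(-1) ^ i : ℤ) = (-1) ^ (i + 1) := by ring
      rw [tailBlocks, e, add_assoc k, hb, ← List.append_assoc, ← List.range'_append_1,
        List.map_append, ← add_assoc k, expo_succ]
      congr 1
      rw [gap, ← List.range'_append_1, List.map_append]
      congr 1
      · rw [eq_comm, List.eq_replicate_iff]
        refine ⟨by simp, ?_⟩
        intro b hb
        obtain ⟨n, hn, rfl⟩ := List.mem_map.mp hb
        rw [List.mem_range'_1] at hn
        obtain ⟨s, rfl⟩ := Nat.exists_eq_add_of_le hn.1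
        rw [h.psum_block hd hw (by unfold gap; omega), if_pos (by omega)]
      · rw [eq_comm, List.eq_replicate_iff]
        refine ⟨by simp, ?_⟩
        intro b hb
        obtain ⟨n, hn, rfl⟩ := List.mem_map.mp hb
        rw [List.mem_range'_1] at hn
        obtain ⟨s, rfl⟩ := Nat.exists_eq_add_of_le (show expo d w (k + i) ≤ n by omega)
        rw [h.psum_block hd hw (by unfold gap; omega), if_neg (by omega)]

theorem invProd_eq : invProd {1, 4, 9, 11, 19} =
    geom 19 * (geom 11 * (geom 9 * (geom 4 * geom 1))) := by
  rw [invProd, Finset.prod_insert (by decide), Finset.prod_insert (by decide),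
    Finset.prod_insert (by decide), Finset.prod_insert (by decide), Finset.prod_singleton]
  ring

theorem coeff_nonneg_of_initialSegment {d w k : ℕ} {f : ℤ⟦X⟧}
    (h : IsTailCoeff d w k fun n => PowerSeries.coeff n f) (hd : 0 < d) (hw : 0 < w) {m : ℕ}
    (hm : (initialSegment d w k m).all (fun z => decide (0 ≤ z)) = true) {n : ℕ}
    (hn : expo d w k ≤ n) (hn' : n < expo d w (k + m)) :
    0 ≤ PowerSeries.coeff n (invProd {1, 4, 9, 11, 19} * f) := by
  have hmul := fun {s : ℕ} {g : ℤ⟦X⟧} (hg : ∀ n < expo d w k, PowerSeries.coeff n g = 0) =>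
    coeff_mul_eq_zero_of_lt hg (geom s)
  obtain ⟨L, hL, hb⟩ := h.tailBlocks_eq hd hw m 0
  simp only [add_zero, pow_zero] at hL hb
  have h0 := h.eq_zero
  have hseg : initialSegment d w k m = (List.range' (expo d w k) L).map fun n =>
      PowerSeries.coeff n (invProd {1, 4, 9, 11, 19} * f) := by
    rw [initialSegment, hb, ← funext (coeff_geom_one_mul f),
      divStep_coeff (by norm_num) (hmul h0), divStep_coeff (by norm_num) (hmul (hmul h0)),
      divStep_coeff (by norm_num) (hmul (hmul (hmul h0))),
      divStep_coeff (by norm_num) (hmul (hmul (hmul (hmul h0)))), invProd_eq]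
    simp only [mul_assoc]
  rw [hseg, List.all_map, List.all_eq_true] at hm
  simpa using hm n (by
    rw [List.mem_range'_1]
    omega)

/-! ### The smooth part dominates -/

theorem psum_succ (g : ℕ → ℤ) (n : ℕ) : psum g (n + 1) = psum g n + g (n + 1) :=
  Finset.sum_range_succ _ _

theorem psum_add_of_eq_zero {g : ℕ → ℤ} {a : ℕ} (hg : ∀ n < a, g n = 0) (x : ℕ) :
    psum g (a + x) = psum (fun y => g (a + y)) x := by
  rw [psum, add_assoc, Finset.sum_range_add, psum,
    Finset.sum_eq_zero fun j hj => hg j (Finset.mem_range.mp hj), zero_add]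

theorem psum_eq_zero_of_lt {g : ℕ → ℤ} {a : ℕ} (hg : ∀ n < a, g n = 0) :
    ∀ n < a, psum g n = 0 := fun n hn =>
  Finset.sum_eq_zero fun j hj => hg j (by
    have := Finset.mem_range.mp hj
    omega)

theorem le_psum_small {g : ℕ → ℤ} {h : ℕ}
    (hg : ∀ x, ((min (x + 1) h : ℕ) * ((min (x + 1) h : ℕ) + 1) : ℤ) ≤ 2 * g x)
    {x : ℕ} (hx : x < h) :
    ((x + 1) * (x + 2) * (x + 3) : ℤ) ≤ 6 * psum g x := by
  induction x with
  | zero =>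
    have := hg 0
    rw [min_eq_left (by omega)] at this
    simp only [psum, zero_add, Finset.sum_range_one]
    push_cast at this ⊢
    linarith
  | succ x ih =>
    have := hg (x + 1)
    rw [min_eq_left (by omega)] at this
    have := ih (by omega)
    rw [psum_succ]
    push_cast at *
    linarith

theorem le_psum_psum_small {g : ℕ → ℤ} {h : ℕ}
    (hg : ∀ x, ((min (x + 1) h : ℕ) * ((min (x + 1) h : ℕ) + 1) : ℤ) ≤ 2 * g x)
    {x : ℕ} (hx : x < h) :
    ((x + 1) * (x + 2) * (x + 3) * (x + 4) : ℤ) ≤ 24 * psum (psum g) x := by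
  induction x with
  | zero =>
    have := le_psum_small hg hx
    simp only [psum, zero_add, Finset.sum_range_one] at *
    push_cast at this ⊢
    linarith
  | succ x ih =>
    have := le_psum_small hg hx
    have := ih (by omega)
    rw [psum_succ]
    push_cast at *
    linarith

theorem le_of_large {g : ℕ → ℤ} {h : ℕ}
    (hg : ∀ x, ((min (x + 1) h : ℕ) * ((min (x + 1) h : ℕ) + 1) : ℤ) ≤ 2 * g x)
    (hh : 0 < h) (z : ℕ) : (h * (h + 1) : ℤ) ≤ 2 * g (h - 1 + z) := by
  have := hg (h - 1 + z)
  rwa [min_eq_right (by omega)] at this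

theorem le_psum_large {g : ℕ → ℤ} {h : ℕ}
    (hg : ∀ x, ((min (x + 1) h : ℕ) * ((min (x + 1) h : ℕ) + 1) : ℤ) ≤ 2 * g x)
    (hh : 0 < h) (z : ℕ) :
    (h * (h + 1) * (h + 2 + 3 * z) : ℤ) ≤ 6 * psum g (h - 1 + z) := by
  induction z with
  | zero =>
    obtain ⟨h, rfl⟩ := Nat.exists_eq_succ_of_ne_zero hh.ne'
    have := le_psum_small hg (Nat.lt_succ_self h)
    simp only [Nat.succ_eq_add_one, Nat.add_sub_cancel, add_zero]
    push_cast
    linarith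
  | succ z ih =>
    have := le_of_large hg hh (z + 1)
    rw [← add_assoc] at this ⊢
    rw [psum_succ]
    push_cast
    linarith

theorem le_psum_psum_large {g : ℕ → ℤ} {h : ℕ}
    (hg : ∀ x, ((min (x + 1) h : ℕ) * ((min (x + 1) h : ℕ) + 1) : ℤ) ≤ 2 * g x)
    (hh : 0 < h) (z : ℕ) :
    (h * (h + 1) * ((h + 2) * (h + 3) + 4 * z * (h + 2) + 6 * z * (z + 1)) : ℤ) ≤
      24 * psum (psum g) (h - 1 + z) := by
  induction z with
  | zero =>
    obtain ⟨h, rfl⟩ := Nat.exists_eq_succ_of_ne_zero hh.ne'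
    have := le_psum_psum_small hg (Nat.lt_succ_self h)
    simp only [Nat.succ_eq_add_one, Nat.add_sub_cancel, add_zero]
    push_cast
    linarith
  | succ z ih =>
    have := le_psum_large hg hh (z + 1)
    rw [← add_assoc] at this ⊢
    rw [psum_succ]
    push_cast at *
    linarith

theorem expo_add_mul_gap_le (d w k i : ℕ) :
    expo d w k + i * gap d w k ≤ expo d w (k + i) := by
  induction i with
  | zero => simp
  | succ i ih =>
    have : gap d w k ≤ gap d w (k + i) := by
      unfold gap cut
      gcongr <;> omega
    rw [← add_assoc k, expo_succ, Nat.succ_mul]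
    omega

/-- The final comparison, with `2 k - 1 + z` the distance from the first exponent. On the right,
`30 = 720 / 24`, `2340 = 14040 / 6` and `63330 = 126660 / 2` come from the coefficients in
`partial_fractions` and the denominators in the lower bounds for the iterated partial sums. On the
left, `11382110 = 2 * 5013325 + 2 * 677730` bounds the loss per block, caused by the fluctuation and
by the second partial sums for `d ≤ 2`, and `2245925` the loss caused by the first partial sums. -/
theorem numeric_bound {k z : ℤ}
    (h : (k = 1 ∧ 1286 ≤ z) ∨ (k = 2 ∧ 218 ≤ z) ∨ (k = 3 ∧ 66 ≤ z) ∨ (k = 4 ∧ 25 ≤ z) ∨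
      (5 ≤ k ∧ 3 * k + 4 ≤ z)) :
    11382110 * (5 * k + 3 + (2 * k - 1 + z)) + 2245925 * (5 * k + 3) ≤
      (5 * k + 3) * ((2 * k) * (2 * k + 1) *
        (30 * ((2 * k + 2) * (2 * k + 3) + 4 * z * (2 * k + 2) + 6 * z * (z + 1)) +
          2340 * (2 * k + 2 + 3 * z) + 63330)) := by
  rcases h with ⟨rfl, h⟩ | ⟨rfl, h⟩ | ⟨rfl, h⟩ | ⟨rfl, h⟩ | ⟨h5, h⟩
  · nlinarith
  · nlinarith
  · nlinarith
  · nlinarith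
  · obtain ⟨u, rfl⟩ := Int.exists_add_of_le h5
    obtain ⟨v, rfl⟩ := Int.exists_add_of_le h
    rw [← sub_nonneg]
    ring_nf
    positivity

theorem coeff_geom_one_pow_mul (f : ℤ⟦X⟧) (m n : ℕ) :
    PowerSeries.coeff n (geom 1 ^ m * f) = psum^[m] (fun j => PowerSeries.coeff j f) n := by
  induction m generalizing f with
  | zero => simp
  | succ m ih =>
    rw [pow_succ, mul_assoc, ih, Function.iterate_succ_apply, ← funext (coeff_geom_one_mul f)]

/-- Far enough from the first exponent, the smooth part of the coefficients, which grows at least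
quadratically, outweighs the linearly growing bound for the rest. -/
theorem coeff_nonneg_of_large {d w k : ℕ} {f : ℤ⟦X⟧}
    (h : IsTailCoeff d w k fun n => PowerSeries.coeff n f) (hd : 0 < d) (hw : 0 < w)
    (hd2 : d ≤ 2) (hgap : 5 * k + 3 ≤ gap d w k) {x : ℕ}
    (hx : (k = 1 ∧ 1287 ≤ x) ∨ (k = 2 ∧ 221 ≤ x) ∨ (k = 3 ∧ 71 ≤ x) ∨ (k = 4 ∧ 32 ≤ x) ∨
      (5 ≤ k ∧ 5 * k + 3 ≤ x)) :
    0 ≤ PowerSeries.coeff (expo d w k + x) (invProd {1, 4, 9, 11, 19} * f) := by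
  set τ : ℕ → ℤ := fun n => PowerSeries.coeff n f
  have hk : 0 < k := by omega
  obtain ⟨i, s, hs, hn⟩ := exists_block (n := expo d w k + x) hd (Nat.le_add_right _ _)
  -- The terms of the decomposition that need not be positive.
  have hfluct : -(5013325 * (2 * (i + 1)) : ℤ) ≤
      PowerSeries.coeff (expo d w k + x) (fluctuation * f) := by
    have h1 := abs_coeff_mul_le abs_coeff_fluctuation_le f (expo d w k + x)
    have h2 := h.sum_range_abs_le hs
    rw [← hn] at h2
    have h3 := neg_abs_le (PowerSeries.coeff (expo d w k + x) (fluctuation * f))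
    linarith
  have h1 := h.neg_one_le_psum hd hw (expo d w k + x)
  have h2 : -(2 * (i + 1) : ℤ) ≤ psum (psum τ) (expo d w k + x) := by
    have := h.le_psum_psum hd hw hs
    rw [← hn] at this
    have hd2' : (d : ℤ) ≤ 2 := by exact_mod_cast hd2
    nlinarith [i.cast_nonneg (α := ℤ)]
  have hi : (5 * k + 3) * i ≤ x := by
    have := expo_add_mul_gap_le d w k i
    have := Nat.mul_le_mul_left i hgap
    rw [mul_comm (5 * k + 3)]
    omega
  -- The smooth part.
  -- The lower bound for the third partial sums is constant from the distance `2 * k - 1` on.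
  obtain ⟨z, rfl⟩ : ∃ z, x = 2 * k - 1 + z := Nat.exists_eq_add_of_le (by omega)
  have hg := h.le_psum_psum_psum hd hw hk
  have z3 := psum_eq_zero_of_lt (psum_eq_zero_of_lt (psum_eq_zero_of_lt h.eq_zero))
  have z4 := psum_eq_zero_of_lt z3
  have b3 := le_of_large hg (by omega) z
  have b4 := le_psum_large hg (by omega) z
  have b5 := le_psum_psum_large hg (by omega) z
  rw [← psum_add_of_eq_zero z3] at b4
  rw [← funext (psum_add_of_eq_zero z3), ← psum_add_of_eq_zero z4] at b5
  have hnum := numeric_bound (k := k) (z := z) (by omega)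
  have key : (5417280 : ℤ) * PowerSeries.coeff (expo d w k + (2 * k - 1 + z))
      (invProd {1, 4, 9, 11, 19} * f) =
      720 * psum (psum (psum (psum (psum τ)))) (expo d w k + (2 * k - 1 + z)) +
      14040 * psum (psum (psum (psum τ))) (expo d w k + (2 * k - 1 + z)) +
      126660 * psum (psum (psum τ)) (expo d w k + (2 * k - 1 + z)) +
      677730 * psum (psum τ) (expo d w k + (2 * k - 1 + z)) +
      2245925 * psum τ (expo d w k + (2 * k - 1 + z)) +
      PowerSeries.coeff (expo d w k + (2 * k - 1 + z)) (fluctuation * f) := by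
    have hmul : ∀ (a : ℤ) (g : ℤ⟦X⟧) (n : ℕ), PowerSeries.coeff n ((a : ℤ⟦X⟧) * g) =
        a * PowerSeries.coeff n g := by
      intro a g n
      rw [← zsmul_eq_mul, map_zsmul, smul_eq_mul]
    have hcoeff := coeff_geom_one_pow_mul f
    have := congrArg (fun g => PowerSeries.coeff (expo d w k + (2 * k - 1 + z)) (g * f))
      partial_fractions
    simp only [add_mul, mul_assoc, map_add] at this
    have c0 := hmul 5417280
    have c5 := hmul 720
    have c4 := hmul 14040
    have c3 := hmul 126660
    have c2 := hmul 677730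
    have c1 := hmul 2245925
    push_cast at c0 c1 c2 c3 c4 c5
    rw [c0, c1, c2, c3, c4, c5, hcoeff, hcoeff, hcoeff, hcoeff, coeff_geom_one_mul] at this
    exact this
  have hi' : ((5 * k + 3) * i : ℤ) ≤ 2 * k - 1 + z := by
    have : (((5 * k + 3) * i : ℕ) : ℤ) ≤ ((2 * k - 1 + z : ℕ) : ℤ) := by exact_mod_cast hi
    rw [Nat.cast_add, Nat.cast_sub (by omega)] at this
    push_cast at this
    exact this
  have hsum : ((2 * k) * (2 * k + 1) *
        (30 * ((2 * k + 2) * (2 * k + 3) + 4 * z * (2 * k + 2) + 6 * z * (z + 1)) +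
          2340 * (2 * k + 2 + 3 * z) + 63330) : ℤ) - 11382110 * (i + 1) - 2245925 ≤
      5417280 * PowerSeries.coeff (expo d w k + (2 * k - 1 + z))
        (invProd {1, 4, 9, 11, 19} * f) := by
    rw [key]
    push_cast at b3 b4 b5
    linarith
  -- The block number `i` is at most `x / (5 * k + 3)`.
  have hpos : (0 : ℤ) < 5 * k + 3 := by positivity
  have := mul_le_mul_of_nonneg_left hsum hpos.le
  refine nonneg_of_mul_nonneg_right (a := ((5 * k + 3) * 5417280 : ℤ)) ?_ (by positivity)
  rw [mul_assoc]
  refine le_trans ?_ this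
  linarith

/-- Before the second exponent of the tail, no term of negative sign contributes. -/
theorem coeff_nonneg_of_small {d w k : ℕ} {f : ℤ⟦X⟧}
    (h : IsTailCoeff d w k fun n => PowerSeries.coeff n f) (hd : 0 < d) (hw : 0 < w) {n : ℕ}
    (hn : n < expo d w (k + 1)) :
    0 ≤ PowerSeries.coeff n (invProd {1, 4, 9, 11, 19} * f) := by
  have hpos : ∀ n, 0 ≤ PowerSeries.coeff n (geom 19 * (geom 11 * (geom 9 * geom 4))) :=
    coeff_mul_nonneg (coeff_geom_nonneg (by norm_num))
      (coeff_mul_nonneg (coeff_geom_nonneg (by norm_num))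
        (coeff_mul_nonneg (coeff_geom_nonneg (by norm_num)) (coeff_geom_nonneg (by norm_num))))
  rw [show invProd {1, 4, 9, 11, 19} * f =
    geom 19 * (geom 11 * (geom 9 * geom 4)) * (geom 1 * f) by rw [invProd_eq]; ring,
    PowerSeries.coeff_mul]
  refine Finset.sum_nonneg fun p hp => mul_nonneg (hpos _) ?_
  rw [coeff_geom_one_mul]
  refine h.psum_nonneg_of_lt hd hw ?_
  have := Finset.HasAntidiagonal.mem_antidiagonal.mp hp
  omega

/-- The pairs `(d, w)` with `A = d + w / 2`, `B = w / 2` for the exponents considered here. -/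
def IsAdmissible (d w : ℕ) : Prop :=
  (d = 1 ∧ w = 3) ∨ (d = 2 ∧ w = 1) ∨ (d = 1 ∧ w = 5) ∨ (d = 2 ∧ w = 3)

/-- The nonnegativity of all coefficients; for `k ≤ 4` the given numbers of blocks cover the range
that is not covered by `coeff_nonneg_of_large`. -/
theorem coeff_nonneg {d w k : ℕ} (hdw : IsAdmissible d w) (hk : 1 ≤ k) {f : ℤ⟦X⟧}
    (h : IsTailCoeff d w k fun n => PowerSeries.coeff n f) (n : ℕ) :
    0 ≤ PowerSeries.coeff n (invProd {1, 4, 9, 11, 19} * f) := by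
  have hd : 0 < d := by unfold IsAdmissible at hdw; omega
  have hw : 0 < w := by unfold IsAdmissible at hdw; omega
  have hgap : 5 * k + 3 ≤ gap d w k := by
    unfold gap cut
    rcases hdw with ⟨rfl, rfl⟩ | ⟨rfl, rfl⟩ | ⟨rfl, rfl⟩ | ⟨rfl, rfl⟩ <;> omega
  rcases lt_or_ge n (expo d w (k + 1)) with hn | hn
  · exact coeff_nonneg_of_small h hd hw hn
  have hn' : expo d w k ≤ n := (expo_mono d w (Nat.le_succ k)).trans hn
  obtain ⟨x, rfl⟩ := Nat.exists_eq_add_of_le hn'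
  rw [expo_succ] at hn
  by_cases hx : (k = 1 ∧ 1287 ≤ x) ∨ (k = 2 ∧ 221 ≤ x) ∨ (k = 3 ∧ 71 ≤ x) ∨ (k = 4 ∧ 32 ≤ x) ∨
      (5 ≤ k ∧ 5 * k + 3 ≤ x)
  · exact coeff_nonneg_of_large h hd hw (by unfold IsAdmissible at hdw; omega) hgap hx
  have hcases : (k = 1 ∧ x < 1287) ∨ (k = 2 ∧ x < 221) ∨ (k = 3 ∧ x < 71) ∨ (k = 4 ∧ x < 32) := by
    omega
  clear hx
  rcases hcases with ⟨rfl, hx⟩ | ⟨rfl, hx⟩ | ⟨rfl, hx⟩ | ⟨rfl, hx⟩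
  · refine coeff_nonneg_of_initialSegment h hd hw (m := 22) ?_ hn' ?_
    · rcases hdw with ⟨rfl, rfl⟩ | ⟨rfl, rfl⟩ | ⟨rfl, rfl⟩ | ⟨rfl, rfl⟩ <;> decide +kernel
    · refine (Nat.add_lt_add_left hx _).trans_le ?_
      rcases hdw with ⟨rfl, rfl⟩ | ⟨rfl, rfl⟩ | ⟨rfl, rfl⟩ | ⟨rfl, rfl⟩ <;> decide
  · refine coeff_nonneg_of_initialSegment h hd hw (m := 8) ?_ hn' ?_
    · rcases hdw with ⟨rfl, rfl⟩ | ⟨rfl, rfl⟩ | ⟨rfl, rfl⟩ | ⟨rfl, rfl⟩ <;> decide +kernel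
    · refine (Nat.add_lt_add_left hx _).trans_le ?_
      rcases hdw with ⟨rfl, rfl⟩ | ⟨rfl, rfl⟩ | ⟨rfl, rfl⟩ | ⟨rfl, rfl⟩ <;> decide
  · refine coeff_nonneg_of_initialSegment h hd hw (m := 4) ?_ hn' ?_
    · rcases hdw with ⟨rfl, rfl⟩ | ⟨rfl, rfl⟩ | ⟨rfl, rfl⟩ | ⟨rfl, rfl⟩ <;> decide +kernel
    · refine (Nat.add_lt_add_left hx _).trans_le ?_
      rcases hdw with ⟨rfl, rfl⟩ | ⟨rfl, rfl⟩ | ⟨rfl, rfl⟩ | ⟨rfl, rfl⟩ <;> decide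
  · refine coeff_nonneg_of_initialSegment h hd hw (m := 2) ?_ hn' ?_
    · rcases hdw with ⟨rfl, rfl⟩ | ⟨rfl, rfl⟩ | ⟨rfl, rfl⟩ | ⟨rfl, rfl⟩ <;> decide +kernel
    · refine (Nat.add_lt_add_left hx _).trans_le ?_
      rcases hdw with ⟨rfl, rfl⟩ | ⟨rfl, rfl⟩ | ⟨rfl, rfl⟩ | ⟨rfl, rfl⟩ <;> decide

/-! ### The infinite product -/

theorem multipliable_geom (r : ℕ) {m : ℕ} (hr : 0 < r) (hm : 0 < m) :
    Multipliable fun i : ℕ => geom (r + m * i) := by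
  have h := PowerSeries.WithPiTopology.multipliable_one_add_of_tendsto_order_atTop_nhds_top
    (R := ℤ) (f := fun i : ℕ => geom (r + m * i) - 1) ?_
  · simpa using h
  · refine ENat.tendsto_nhds_top_iff_natCast_lt.mpr fun n => ?_
    filter_upwards [Filter.eventually_gt_atTop n] with i hi
    refine lt_of_lt_of_le (b := ((r + m * i : ℕ) : ℕ∞)) (by norm_cast; nlinarith) ?_
    refine PowerSeries.le_order _ _ fun j hj => ?_
    rw [Nat.cast_lt] at hj
    rw [geom_eq_mk (by omega), map_sub, PowerSeries.coeff_mk, PowerSeries.coeff_one]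
    have : r + m * i ∣ j ↔ j = 0 :=
      ⟨fun h => Nat.eq_zero_of_dvd_of_lt h hj, by rintro rfl; simp⟩
    simp [this]

theorem tprod_geom_mul_qPochInf {r m : ℕ} (hr : 0 < r) (hm : 0 < m) :
    (∏' i : ℕ, geom (r + m * i)) * qPochInf (PowerSeries.X ^ r) (PowerSeries.X ^ m) = 1 := by
  rw [qPochInf, ← (multipliable_geom r hr hm).tprod_mul (multipliable_qPochInf r hm)]
  convert tprod_one with i
  rw [← pow_mul, ← pow_add, mul_comm, one_sub_X_pow_mul_inverse (by omega)]

theorem hasProd_inverse_qPochInf :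
    HasProd (fun i : ℕ => geom (1 + 5 * i) * geom (4 + 5 * i))
      (Ring.inverse (qPochInf PowerSeries.X (PowerSeries.X ^ 5) *
        qPochInf (PowerSeries.X ^ 4) (PowerSeries.X ^ 5))) := by
  have h1 := tprod_geom_mul_qPochInf (r := 1) (m := 5) one_pos (by norm_num)
  have h4 := tprod_geom_mul_qPochInf (r := 4) (m := 5) (by norm_num) (by norm_num)
  rw [pow_one] at h1
  have hQ : qPochInf PowerSeries.X (PowerSeries.X ^ 5) *
      qPochInf (PowerSeries.X ^ 4) (PowerSeries.X ^ 5) *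
      ((∏' i : ℕ, geom (1 + 5 * i)) * ∏' i : ℕ, geom (4 + 5 * i)) = 1 := by
    linear_combination (∏' i : ℕ, geom (4 + 5 * i)) *
      qPochInf (PowerSeries.X ^ 4) (PowerSeries.X ^ 5) * h1 + h4
  rw [← mul_one (Ring.inverse _), ← hQ, Ring.inverse_mul_cancel_left _ _ (.of_mul_eq_one _ hQ)]
  exact (multipliable_geom 1 one_pos (by norm_num)).hasProd.mul
    (multipliable_geom 4 (by norm_num) (by norm_num)).hasProd

/-- The factors `1 / (1 - q^s)` with `s ∈ {1, 4, 9, 11, 19}` occur among the first four pairs of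
factors of the infinite product, and the remaining ones have nonnegative coefficients. -/
theorem coeff_inverse_qPochInf_mul_nonneg {f : ℤ⟦X⟧}
    (hf : ∀ n, 0 ≤ PowerSeries.coeff n (invProd {1, 4, 9, 11, 19} * f)) (n : ℕ) :
    0 ≤ PowerSeries.coeff n (Ring.inverse (qPochInf PowerSeries.X (PowerSeries.X ^ 5) *
      qPochInf (PowerSeries.X ^ 4) (PowerSeries.X ^ 5)) * f) := by
  have hlim := ((PowerSeries.WithPiTopology.continuous_coeff ℤ n).tendsto _).comp
    (hasProd_inverse_qPochInf.tendsto_prod_nat.mul_const f)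
  refine ge_of_tendsto hlim ?_
  filter_upwards [Filter.eventually_ge_atTop 4] with N hN
  obtain ⟨N, rfl⟩ := Nat.exists_eq_add_of_le hN
  have hsplit : (∏ i ∈ Finset.range (4 + N), (geom (1 + 5 * i) * geom (4 + 5 * i))) * f =
      (geom 6 * (geom 14 * geom 16) *
        ∏ i ∈ Finset.range N, (geom (1 + 5 * (4 + i)) * geom (4 + 5 * (4 + i)))) *
        (invProd {1, 4, 9, 11, 19} * f) := by
    rw [Finset.prod_range_add, invProd_eq]
    simp only [Finset.prod_range_succ, Finset.prod_range_zero]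
    norm_num
    ring
  rw [Function.comp_apply, hsplit]
  refine coeff_mul_nonneg (coeff_mul_nonneg ?_ (coeff_prod_nonneg _ fun i _ => ?_)) hf n
  · exact coeff_mul_nonneg (coeff_geom_nonneg (by norm_num))
      (coeff_mul_nonneg (coeff_geom_nonneg (by norm_num)) (coeff_geom_nonneg (by norm_num)))
  · exact coeff_mul_nonneg (coeff_geom_nonneg (by omega)) (coeff_geom_nonneg (by omega))

theorem isNatSeries_of_coeff_nonneg {f : ℤ⟦X⟧} (hf : ∀ n, 0 ≤ PowerSeries.coeff n f) :
    IsNatSeries f := by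
  refine ⟨PowerSeries.mk fun n => (PowerSeries.coeff n f).toNat, ?_⟩
  ext n
  simp [hf n]

end PentagonalPositivity

theorem mainTheorem3 (A B : ℚ)
    (hAB : (A, B) ∈ ({(5 / 2, 3 / 2), (5 / 2, 1 / 2), (7 / 2, 5 / 2), (7 / 2, 3 / 2)} :
      Set (ℚ × ℚ))) :
    (∀ k n : ℕ, 1 ≤ k → 0 ≤ PentagonalPositivity.gammaCoeff {1, 4, 9, 11, 19} A B k n) ∧
    (∀ k : ℕ, 1 ≤ k →
      PentagonalPositivity.IsNatSeries
        (Ring.inverse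
            (PentagonalPositivity.qPochInf PowerSeries.X (PowerSeries.X ^ 5) *
              PentagonalPositivity.qPochInf (PowerSeries.X ^ 4) (PowerSeries.X ^ 5)) *
          PentagonalPositivity.tailSeries A B k)) := by
  obtain ⟨d, w, hdw, rfl, rfl⟩ : ∃ d w : ℕ, PentagonalPositivity.IsAdmissible d w ∧
      (d + w / 2 : ℚ) = A ∧ (w / 2 : ℚ) = B := by
    simp only [Set.mem_insert_iff, Set.mem_singleton_iff, Prod.mk.injEq] at hAB
    rcases hAB with ⟨rfl, rfl⟩ | ⟨rfl, rfl⟩ | ⟨rfl, rfl⟩ | ⟨rfl, rfl⟩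
    · exact ⟨1, 3, by simp [PentagonalPositivity.IsAdmissible], by norm_num, by norm_num⟩
    · exact ⟨2, 1, by simp [PentagonalPositivity.IsAdmissible], by norm_num, by norm_num⟩
    · exact ⟨1, 5, by simp [PentagonalPositivity.IsAdmissible], by norm_num, by norm_num⟩
    · exact ⟨2, 3, by simp [PentagonalPositivity.IsAdmissible], by norm_num, by norm_num⟩
  have hd : 0 < d := by unfold PentagonalPositivity.IsAdmissible at hdw; omega
  have hw : 0 < w := by unfold PentagonalPositivity.IsAdmissible at hdw; omega
  have hpos := fun (k : ℕ) (hk : 1 ≤ k) => PentagonalPositivity.coeff_nonneg hdw hk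
    (PentagonalPositivity.isTailCoeff_tailSeries hd hw k)
  exact ⟨fun k n hk => hpos k hk n, fun k hk =>
    PentagonalPositivity.isNatSeries_of_coeff_nonneg
      (PentagonalPositivity.coeff_inverse_qPochInf_mul_nonneg (hpos k hk))⟩
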